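/- For $p\ge 0$ let $\mathrm{T}_p$ be the algebra of real upper triangular (diagonal included) $p\times p$ matrices with the operator norm $\|\cdot\|_p$ of Euclidean $\mathbb{R}^p$. For $m\ge 0$ let $C^\infty(\mathbb{R}^m,\mathrm{T}_p)$ be the real algebra, under pointwise operations, of infinitely differentiable functions $\mathbb{R}^m\to \mathrm{T}_p$, with the topology given by the seminorms $$\|f\|_{p,K,n}=\sum_{\beta\in\mathbb{Z}_+^m,\ |\beta|=n}\ \max_{x\in K}\|f^{(\beta)}(x)\|_p ,$$ where $n\in\mathbb{Z}_+$ and $K\subset\mathbb{R}^m$ is compact (the maximum over $K=\emptyset$ being $0$). A real or complex Arens–Michael algebra is a unital associative complete Hausdorff topological algebra whose topology is given by a family of submultiplicative seminorms. An element $b$ of a complex Arens–Michael algebra $B$ has polynomial growth if for every continuous submultiplicative seminorm $\|\cdot\|$ on $B$ there are $K>0$ and $\alpha\ge 0$ such that $\|e^{isb}\|\le K(1+|s|)^{\alpha}$ for all $s\in\mathbb{R}$, where $e^{isb}=\sum_{n\ge 0}(isb)^n/n!$ (a convergent series). An element of a real Arens–Michael algebra $A$ has polynomial growth if it has polynomial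 growth in the complexification $A_{\mathbb{C}}=\mathbb{C}\otimes_{\mathbb{R}}A=A\oplus iA$, which carries the topology of $A\times A$. A real Arens–Michael algebra has polynomial growth if all of its elements have polynomial growth. **Theorem.** For all integers $m,p\ge 0$, $C^\infty(\mathbb{R}^m,\mathrm{T}_p)$ is a real Arens–Michael algebra of polynomial growth. -/

import Mathlib

open scoped ContDiff TensorProduct

/-! ### Arens–Michael algebras -/

/-- A unital associative topological algebra `A` over `𝕜` is an Arens–Michael algebra if it is
Hausdorff and complete and its topology is given by some family of submultiplicative seminorms. -/
structure IsArensMichael (𝕜 A : Type*) [NormedField 𝕜] [Ring A] [Algebra 𝕜 A]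
    [UniformSpace A] [IsUniformAddGroup A] : Prop where
  t2 : T2Space A
  complete : CompleteSpace A
  exists_seminorms : ∃ S : Set (Seminorm 𝕜 A),
    (∀ q ∈ S, ∀ x y : A, q (x * y) ≤ q x * q y) ∧
      WithSeminorms (fun q : S => (q : Seminorm 𝕜 A))

/-! ### Complexification -/

/-- The complexification `ℂ ⊗[ℝ] A = A ⊕ iA` of a real algebra. -/
def Complexification (A : Type*) [Ring A] [Algebra ℝ A] : Type _ := ℂ ⊗[ℝ] A

namespace Complexification

variable (A : Type*) [Ring A] [Algebra ℝ A]

noncomputable instance : Ring (Complexification A) := inferInstanceAs (Ring (ℂ ⊗[ℝ] A))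

noncomputable instance : Algebra ℂ (Complexification A) :=
  inferInstanceAs (Algebra ℂ (ℂ ⊗[ℝ] A))

variable {A}

/-- The element `a + ib` of the complexification. -/
noncomputable def mk (a b : A) : Complexification A :=
  ((1 : ℂ) ⊗ₜ[ℝ] a + Complex.I ⊗ₜ[ℝ] b : ℂ ⊗[ℝ] A)

variable (A)

/-- The topology of `A × A`, transported along the bijection `(a, b) ↦ a + ib`. -/
noncomputable instance [TopologicalSpace A] : TopologicalSpace (Complexification A) :=
  TopologicalSpace.coinduced (fun z : A × A => mk z.1 z.2) inferInstance

end Complexification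

/-! ### Polynomial growth -/

/-- An element `b` of a complex topological algebra has polynomial growth: the exponential series
of `isb` converges for every real `s`, with sum `e s`, and for every continuous submultiplicative
seminorm `q` there are `K > 0` and `α ≥ 0` with `q (e s) ≤ K (1 + |s|) ^ α` for all real `s`. -/
def HasPolynomialGrowth {B : Type*} [Ring B] [Algebra ℂ B] [TopologicalSpace B] (b : B) : Prop :=
  ∃ e : ℝ → B,
    (∀ s : ℝ, HasSum (fun n : ℕ => ((n.factorial : ℂ)⁻¹) • ((Complex.I * (s : ℂ)) • b) ^ n) (e s)) ∧
    ∀ q : Seminorm ℂ B, Continuous q → (∀ x y : B, q (x * y) ≤ q x * q y) →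
      ∃ K α : ℝ, 0 < K ∧ 0 ≤ α ∧ ∀ s : ℝ, q (e s) ≤ K * (1 + |s|) ^ α

/-- A real Arens–Michael algebra has polynomial growth if each of its elements has polynomial
growth in the complexification. -/
structure IsPolynomialGrowthAlgebra (A : Type*) [Ring A] [Algebra ℝ A]
    [UniformSpace A] [IsUniformAddGroup A] : Prop where
  isArensMichael : IsArensMichael ℝ A
  hasPolynomialGrowth : ∀ a : A, HasPolynomialGrowth (Complexification.mk a 0)

/-! ### Smooth functions on `ℝ^m` with values in a normed algebra -/

section Smooth

variable (m : ℕ) (A : Type*) [NormedRing A] [NormedAlgebra ℝ A]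

/-- The infinitely differentiable functions `ℝ^m → A`, with pointwise operations. -/
def smoothSubalgebra : Subalgebra ℝ (EuclideanSpace ℝ (Fin m) → A) where
  carrier := {f | ContDiff ℝ ∞ f}
  mul_mem' {f g} hf hg := by
    rw [Set.mem_ofPred_eq] at hf hg ⊢
    exact hf.mul hg
  add_mem' {f g} hf hg := by
    rw [Set.mem_ofPred_eq] at hf hg ⊢
    exact hf.add hg
  algebraMap_mem' r := by
    rw [Set.mem_ofPred_eq]
    exact contDiff_const (c := algebraMap ℝ A r)

/-- The algebra `C^∞(ℝ^m, A)`. (A separate type, so that it does not carry the topology of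
pointwise convergence.) -/
def SmoothFun : Type _ := ↥(smoothSubalgebra m A)

namespace SmoothFun

noncomputable instance : Ring (SmoothFun m A) := inferInstanceAs (Ring ↥(smoothSubalgebra m A))

noncomputable instance : Algebra ℝ (SmoothFun m A) :=
  inferInstanceAs (Algebra ℝ ↥(smoothSubalgebra m A))

variable {m A}

instance : CoeFun (SmoothFun m A) (fun _ => EuclideanSpace ℝ (Fin m) → A) := ⟨fun f => f.1⟩

theorem contDiff (f : SmoothFun m A) : ContDiff ℝ ∞ (f : EuclideanSpace ℝ (Fin m) → A) := f.2

theorem differentiable (f : SmoothFun m A) :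
    Differentiable ℝ (f : EuclideanSpace ℝ (Fin m) → A) := f.contDiff.differentiable (by simp)

/-- The partial derivative `∂f/∂x_i`, as a linear operator on `C^∞(ℝ^m, A)`. -/
noncomputable def partialDeriv (i : Fin m) : Module.End ℝ (SmoothFun m A) where
  toFun f := ⟨fun x => fderiv ℝ (f : EuclideanSpace ℝ (Fin m) → A) x (EuclideanSpace.single i 1),
    (f.contDiff.fderiv_right (m := ∞) (by simp)).clm_apply contDiff_const⟩
  map_add' f g := Subtype.ext <| funext fun x => by
    change fderiv ℝ ((f : EuclideanSpace ℝ (Fin m) → A) + (g : EuclideanSpace ℝ (Fin m) → A)) x _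
      = fderiv ℝ (f : EuclideanSpace ℝ (Fin m) → A) x _
        + fderiv ℝ (g : EuclideanSpace ℝ (Fin m) → A) x _
    rw [fderiv_add (f.differentiable x) (g.differentiable x)]; rfl
  map_smul' c f := Subtype.ext <| funext fun x => by
    change fderiv ℝ (c • (f : EuclideanSpace ℝ (Fin m) → A)) x _
      = c • fderiv ℝ (f : EuclideanSpace ℝ (Fin m) → A) x _
    rw [fderiv_const_smul (f.differentiable x)]; rfl

/-- The partial derivative `f^{(β)} = ∂_1^{β_1} ⋯ ∂_m^{β_m} f` for a multi-index `β`. -/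
noncomputable def multiDeriv (β : Fin m → ℕ) : Module.End ℝ (SmoothFun m A) :=
  ((List.finRange m).map fun i => partialDeriv i ^ β i).prod

theorem bddAbove_norm (K : TopologicalSpace.Compacts (EuclideanSpace ℝ (Fin m)))
    (f : SmoothFun m A) : BddAbove (Set.range fun x : K => ‖f x‖) := by
  have h := (K.isCompact.image_of_continuousOn (f.contDiff.continuous.norm.continuousOn)).bddAbove
  rwa [Set.image_eq_range] at h

/-- The seminorm `f ↦ max_{x ∈ K} ‖f x‖`, for a compact set `K`. -/
noncomputable def supSeminorm (K : TopologicalSpace.Compacts (EuclideanSpace ℝ (Fin m))) :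
    Seminorm ℝ (SmoothFun m A) :=
  Seminorm.of (fun f => ⨆ x : K, ‖f x‖)
    (fun f g => by
      refine Real.iSup_le (fun x => ?_) (add_nonneg (Real.iSup_nonneg fun _ => norm_nonneg _)
        (Real.iSup_nonneg fun _ => norm_nonneg _))
      exact (norm_add_le (f x) (g x)).trans
        (add_le_add (le_ciSup (bddAbove_norm K f) x) (le_ciSup (bddAbove_norm K g) x)))
    (fun c f => by
      change (⨆ x : K, ‖c • f x‖) = ‖c‖ * ⨆ x : K, ‖f x‖
      simp_rw [norm_smul]
      exact (Real.mul_iSup_of_nonneg (norm_nonneg c) _).symm)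

variable (m A)

/-- The seminorms `‖f‖_{K,n} = ∑_{|β| = n} max_{x ∈ K} ‖f^{(β)} x‖`. -/
noncomputable def seminormFamily : SeminormFamily ℝ (SmoothFun m A)
    (TopologicalSpace.Compacts (EuclideanSpace ℝ (Fin m)) × ℕ) := fun i =>
  ∑ β ∈ Finset.piAntidiag (Finset.univ : Finset (Fin m)) i.2,
    (supSeminorm i.1).comp (multiDeriv β)

/-- The topology of `C^∞(ℝ^m, A)`, given by the seminorms `‖·‖_{K,n}`. -/
noncomputable instance : TopologicalSpace (SmoothFun m A) :=
  (seminormFamily m A).moduleFilterBasis.topology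

theorem withSeminorms : WithSeminorms (seminormFamily m A) := ⟨rfl⟩

instance : IsTopologicalAddGroup (SmoothFun m A) := (withSeminorms m A).topologicalAddGroup

noncomputable instance : UniformSpace (SmoothFun m A) :=
  IsTopologicalAddGroup.rightUniformSpace (SmoothFun m A)

instance : IsUniformAddGroup (SmoothFun m A) := isUniformAddGroup_of_addCommGroup

end SmoothFun

end Smooth

/-! ### Triangular matrices -/

/-- The algebra of real upper triangular (diagonal included) matrices of order `p`. -/
abbrev UpperTriangular (p : ℕ) : Type :=
  ↥(Matrix.blockTriangularSubalgebra ℝ ℝ (id : Fin p → Fin p))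

section

open scoped Matrix.Norms.L2Operator

/-- The norm is the operator norm on the `p`-dimensional Euclidean space. -/
noncomputable instance (p : ℕ) : NormedRing (UpperTriangular p) := inferInstance

noncomputable instance (p : ℕ) : NormedAlgebra ℝ (UpperTriangular p) := inferInstance

end

/-! ### The topology of `C^∞(ℝ^m, A)` -/

namespace SmoothFun

variable {m : ℕ} {A : Type*} [NormedRing A] [NormedAlgebra ℝ A]

/-! The exponential e^{isM} of a real triangular matrix M grows polynomially in s: its diagonal
entries are unimodular, and every other entry is obtained by integrating entries closer to the
diagonal. The degree depends only on the size, and the constant only on a bound for the entries of M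
(`Matrix.norm_exp_smul_apply_le`).

Derivatives are reduced to this case. If ρ is a homomorphism and D a derivation, then f ↦ [[ρ f, ρ
(D f)], [0, ρ f]] is again a homomorphism. Starting from evaluation at x and iterating, each entry
of each derivative of f at x becomes an entry of ρ_x(f), where ρ_x maps the algebra into triangular
matrices of a size independent of x (`exists_triangular_representation`). Since ρ_x carries the
exponential series of a to that of ρ_x(a), whose entries are bounded for x in a compact set, every
defining seminorm of the exponential is polynomially bounded.

The series is split into its real and imaginary parts, which converge in the real algebra.
Convergence uses completeness (`completeSpace`) and an equivalent family of submultiplicative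
seminorms (`withSeminorms_mulSeminorm`). -/

@[ext]
theorem ext {f g : SmoothFun m A} (h : ∀ x, f x = g x) : f = g := Subtype.ext (funext h)

theorem partialDeriv_apply (i : Fin m) (f : SmoothFun m A) (x : EuclideanSpace ℝ (Fin m)) :
    partialDeriv i f x = fderiv ℝ (f : EuclideanSpace ℝ (Fin m) → A) x
      (EuclideanSpace.single i 1) := rfl

theorem partialDeriv_mul (i : Fin m) (f g : SmoothFun m A) :
    partialDeriv i (f * g) = partialDeriv i f * g + f * partialDeriv i g := by
  ext x
  change fderiv ℝ ((f : EuclideanSpace ℝ (Fin m) → A) * (g : EuclideanSpace ℝ (Fin m) → A)) x _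
    = fderiv ℝ (f : EuclideanSpace ℝ (Fin m) → A) x _ * g x
      + f x * fderiv ℝ (g : EuclideanSpace ℝ (Fin m) → A) x _
  rw [fderiv_mul' (f.differentiable x) (g.differentiable x)]
  simp [add_comm]

theorem partialDeriv_one (i : Fin m) : partialDeriv i (1 : SmoothFun m A) = 0 := by
  have h := partialDeriv_mul i (1 : SmoothFun m A) 1
  simpa using h

theorem commute_partialDeriv (i j : Fin m) :
    Commute (partialDeriv i : Module.End ℝ (SmoothFun m A)) (partialDeriv j) := by
  have key : ∀ (i j : Fin m) (f : SmoothFun m A) (x : EuclideanSpace ℝ (Fin m)),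
      partialDeriv i (partialDeriv j f) x
        = fderiv ℝ (fderiv ℝ (f : EuclideanSpace ℝ (Fin m) → A)) x (EuclideanSpace.single i 1)
            (EuclideanSpace.single j 1) := by
    intro i j f x
    have h : DifferentiableAt ℝ (fderiv ℝ (f : EuclideanSpace ℝ (Fin m) → A)) x :=
      ((f.contDiff.fderiv_right (m := ∞) (by simp)).differentiable (by simp)) x
    change fderiv ℝ (fun y => fderiv ℝ (f : EuclideanSpace ℝ (Fin m) → A) y
      (EuclideanSpace.single j 1)) x _ = _
    rw [fderiv_clm_apply h (differentiableAt_const _)]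
    simp
  refine LinearMap.ext fun f => ext fun x => ?_
  rw [Module.End.mul_apply, Module.End.mul_apply, key, key]
  exact (f.contDiff.contDiffAt.isSymmSndFDerivAt (by
    rw [minSmoothness_of_isRCLikeNormedField]
    exact WithTop.coe_le_coe.2 (le_top : (2 : ℕ∞) ≤ ⊤))) _ _

theorem partialDeriv_mul_multiDeriv (i : Fin m) (β : Fin m → ℕ) :
    (partialDeriv i * multiDeriv β : Module.End ℝ (SmoothFun m A))
      = multiDeriv (β + Pi.single i 1) := by
  -- Since the list has no repetition, the extra factor appears at most once; it is moved to the
  -- front by commuting partial derivatives.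
  have key : ∀ l : List (Fin m), l.Nodup →
      (l.map fun j => (partialDeriv j : Module.End ℝ (SmoothFun m A))
          ^ (β + Pi.single i 1 : Fin m → ℕ) j).prod
        = (if i ∈ l then partialDeriv i else 1)
          * (l.map fun j => (partialDeriv j : Module.End ℝ (SmoothFun m A)) ^ β j).prod := by
    intro l
    induction l with
    | nil => simp
    | cons j l ih =>
      intro hl
      rw [List.nodup_cons] at hl
      rw [List.map_cons, List.prod_cons, List.map_cons, List.prod_cons, ih hl.2]
      rcases eq_or_ne i j with rfl | hij
      · simp [hl.1, pow_succ', mul_assoc]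
      · have hc : Commute ((partialDeriv j : Module.End ℝ (SmoothFun m A)) ^ β j)
            (if i ∈ l then partialDeriv i else 1) := by
          split_ifs
          · exact (commute_partialDeriv j i).pow_left _
          · exact Commute.one_right _
        simp only [Pi.add_apply, Pi.single_apply, hij.symm, if_false, add_zero, List.mem_cons, hij,
          false_or]
        rw [← mul_assoc, ← mul_assoc, hc.eq]
  rw [multiDeriv, multiDeriv, key _ (List.nodup_finRange m)]
  simp

theorem commute_multiDeriv (β : Fin m → ℕ) (i : Fin m) :
    Commute (partialDeriv i : Module.End ℝ (SmoothFun m A)) (multiDeriv β) := by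
  refine Commute.list_prod_right _ _ fun T hT => ?_
  obtain ⟨j, -, rfl⟩ := List.mem_map.1 hT
  exact (commute_partialDeriv i j).pow_right _

theorem multiDeriv_zero : (multiDeriv 0 : Module.End ℝ (SmoothFun m A)) = 1 := by
  simp [multiDeriv]

variable (m A) in
/-- The monoid of differential operators generated by the partial derivatives. -/
noncomputable def diffOps : Submonoid (Module.End ℝ (SmoothFun m A)) :=
  Submonoid.closure (Set.range partialDeriv)

/-- Words in the partial derivatives can be treated by induction, one derivative at a time, at
either end of the word. -/
theorem multiDeriv_mem_diffOps (β : Fin m → ℕ) : multiDeriv β ∈ diffOps m A := by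
  refine Submonoid.list_prod_mem _ fun T hT => ?_
  obtain ⟨i, -, rfl⟩ := List.mem_map.1 hT
  exact pow_mem (Submonoid.subset_closure (Set.mem_range_self i)) _

theorem norm_le_supSeminorm {K : TopologicalSpace.Compacts (EuclideanSpace ℝ (Fin m))}
    (f : SmoothFun m A) {x : EuclideanSpace ℝ (Fin m)} (hx : x ∈ K) : ‖f x‖ ≤ supSeminorm K f :=
  le_ciSup (bddAbove_norm K f) ⟨x, hx⟩

theorem supSeminorm_le {K : TopologicalSpace.Compacts (EuclideanSpace ℝ (Fin m))}
    {f : SmoothFun m A} {C : ℝ} (hC : 0 ≤ C) (h : ∀ x ∈ K, ‖f x‖ ≤ C) : supSeminorm K f ≤ C :=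
  Real.iSup_le (fun x => h x x.2) hC

theorem supSeminorm_mul_le (K : TopologicalSpace.Compacts (EuclideanSpace ℝ (Fin m)))
    (f g : SmoothFun m A) : supSeminorm K (f * g) ≤ supSeminorm K f * supSeminorm K g :=
  supSeminorm_le (mul_nonneg (apply_nonneg _ _) (apply_nonneg _ _)) fun x hx =>
    (norm_mul_le (f x) (g x)).trans (mul_le_mul (norm_le_supSeminorm f hx)
      (norm_le_supSeminorm g hx) (norm_nonneg _) (apply_nonneg _ _))

theorem seminormFamily_apply (K : TopologicalSpace.Compacts (EuclideanSpace ℝ (Fin m))) (n : ℕ)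
    (f : SmoothFun m A) : seminormFamily m A (K, n) f
      = ∑ β ∈ Finset.piAntidiag (Finset.univ : Finset (Fin m)) n,
          supSeminorm K (multiDeriv β f) := by
  rw [seminormFamily, sum_apply]
  rfl

theorem supSeminorm_multiDeriv_le (K : TopologicalSpace.Compacts (EuclideanSpace ℝ (Fin m)))
    (β : Fin m → ℕ) (f : SmoothFun m A) :
    supSeminorm K (multiDeriv β f) ≤ seminormFamily m A (K, ∑ i, β i) f := by
  rw [seminormFamily_apply]
  exact Finset.single_le_sum (f := fun γ => supSeminorm K (multiDeriv γ f))
    (fun _ _ => apply_nonneg _ _) (by simp)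

theorem continuous_supSeminorm_multiDeriv
    (K : TopologicalSpace.Compacts (EuclideanSpace ℝ (Fin m))) (β : Fin m → ℕ) :
    Continuous ((supSeminorm K).comp (multiDeriv β) : Seminorm ℝ (SmoothFun m A)) :=
  Seminorm.continuous_of_le ((withSeminorms m A).continuous_seminorm (K, ∑ i, β i))
    (supSeminorm_multiDeriv_le K β)

theorem continuous_supSeminorm (K : TopologicalSpace.Compacts (EuclideanSpace ℝ (Fin m))) :
    Continuous (supSeminorm K : Seminorm ℝ (SmoothFun m A)) := by
  have h := continuous_supSeminorm_multiDeriv (A := A) K 0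
  rwa [multiDeriv_zero] at h

/-- Commuting the partial derivative past the multi-index derivatives of order n leaves only
derivatives of order n + 1, which are controlled by the defining seminorms. -/
theorem continuous_partialDeriv (i : Fin m) :
    Continuous (partialDeriv i : SmoothFun m A → SmoothFun m A) := by
  refine WithSeminorms.continuous_of_isBounded (withSeminorms m A) (withSeminorms m A) _ ?_
  rintro ⟨K, n⟩
  refine Seminorm.bound_of_continuous (withSeminorms m A) _ ?_ |>.imp fun s ⟨C, _, h⟩ => ⟨C, h⟩
  have h : ((seminormFamily m A (K, n)).comp (partialDeriv i) : SmoothFun m A → ℝ) = fun f =>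
      ∑ β ∈ Finset.piAntidiag (Finset.univ : Finset (Fin m)) n,
        (supSeminorm K).comp (multiDeriv (β + Pi.single i 1)) f := by
    funext f
    rw [Seminorm.comp_apply, seminormFamily_apply]
    refine Finset.sum_congr rfl fun β _ => ?_
    rw [Seminorm.comp_apply, ← partialDeriv_mul_multiDeriv, (commute_multiDeriv β i).eq]
    rfl
  rw [h]
  exact continuous_finsetSum _ fun β _ => continuous_supSeminorm_multiDeriv K _

theorem continuous_of_mem_diffOps {T : Module.End ℝ (SmoothFun m A)} (hT : T ∈ diffOps m A) :
    Continuous T := by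
  induction hT using Submonoid.closure_induction_left with
  | one => exact continuous_id
  | mul_left T hT U _ ih =>
    obtain ⟨i, rfl⟩ := hT
    exact (continuous_partialDeriv i).comp ih

/-! ### Submultiplicative seminorms -/

/-- The submultiplicative seminorm that sums the maxima on `K` of all iterated partial derivatives
of order at most `n`, with suitable multiplicities. -/
noncomputable def mulSeminorm (K : TopologicalSpace.Compacts (EuclideanSpace ℝ (Fin m))) :
    ℕ → Seminorm ℝ (SmoothFun m A)
  | 0 => supSeminorm K
  | n + 1 => mulSeminorm K n + ∑ i, (mulSeminorm K n).comp (partialDeriv i)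

theorem mulSeminorm_succ_apply (K : TopologicalSpace.Compacts (EuclideanSpace ℝ (Fin m))) (n : ℕ)
    (f : SmoothFun m A) : mulSeminorm K (n + 1) f
      = mulSeminorm K n f + ∑ i, mulSeminorm K n (partialDeriv i f) := by
  rw [mulSeminorm, add_apply, sum_apply]
  rfl

/-- By the Leibniz rule, passing from n to n + 1 yields three of the four terms of the expanded
product; the fourth is nonnegative. -/
theorem mulSeminorm_mul_le (K : TopologicalSpace.Compacts (EuclideanSpace ℝ (Fin m))) (n : ℕ)
    (f g : SmoothFun m A) : mulSeminorm K n (f * g) ≤ mulSeminorm K n f * mulSeminorm K n g := by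
  induction n generalizing f g with
  | zero => exact supSeminorm_mul_le K f g
  | succ n ih =>
    have hd : ∑ i, mulSeminorm K n (partialDeriv i (f * g))
        ≤ (∑ i, mulSeminorm K n (partialDeriv i f)) * mulSeminorm K n g
          + mulSeminorm K n f * ∑ i, mulSeminorm K n (partialDeriv i g) := by
      rw [Finset.sum_mul, Finset.mul_sum, ← Finset.sum_add_distrib]
      refine Finset.sum_le_sum fun i _ => ?_
      rw [partialDeriv_mul]
      exact (map_add_le_add _ _ _).trans (add_le_add (ih _ _) (ih _ _))
    have hf : 0 ≤ ∑ i, mulSeminorm K n (partialDeriv i f) :=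
      Finset.sum_nonneg fun _ _ => apply_nonneg _ _
    have hg : 0 ≤ ∑ i, mulSeminorm K n (partialDeriv i g) :=
      Finset.sum_nonneg fun _ _ => apply_nonneg _ _
    simp only [mulSeminorm_succ_apply]
    linarith [ih f g, mul_nonneg hf hg]

theorem continuous_mulSeminorm (K : TopologicalSpace.Compacts (EuclideanSpace ℝ (Fin m))) (n : ℕ) :
    Continuous (mulSeminorm K n : Seminorm ℝ (SmoothFun m A)) := by
  induction n with
  | zero => exact continuous_supSeminorm K
  | succ n ih =>
    simp_rw [funext (mulSeminorm_succ_apply (A := A) K n)]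
    exact ih.add (continuous_finsetSum _ fun i _ => ih.comp (continuous_partialDeriv i))

theorem exists_supSeminorm_le_mulSeminorm {T : Module.End ℝ (SmoothFun m A)}
    (hT : T ∈ diffOps m A) : ∃ n, ∀ K f, supSeminorm K (T f) ≤ mulSeminorm K n f := by
  induction hT using Submonoid.closure_induction_right with
  | one => exact ⟨0, fun _ _ => le_rfl⟩
  | mul_right T _ U hU ih =>
    obtain ⟨i, rfl⟩ := hU
    obtain ⟨n, hn⟩ := ih
    refine ⟨n + 1, fun K f => (hn K (partialDeriv i f)).trans ?_⟩
    rw [mulSeminorm_succ_apply]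
    have := Finset.single_le_sum (f := fun i => mulSeminorm K n (partialDeriv i f))
      (fun _ _ => apply_nonneg _ _) (Finset.mem_univ i)
    linarith [apply_nonneg (mulSeminorm K n) f]

variable (m A) in
theorem withSeminorms_mulSeminorm : WithSeminorms
    (fun i : TopologicalSpace.Compacts (EuclideanSpace ℝ (Fin m)) × ℕ =>
      (mulSeminorm i.1 i.2 : Seminorm ℝ (SmoothFun m A))) := by
  classical
  refine (withSeminorms m A).congr (fun i => ?_) ?_
  · exact Seminorm.bound_of_continuous (withSeminorms m A) _ (continuous_mulSeminorm i.1 i.2)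
      |>.imp fun s ⟨C, _, h⟩ => ⟨C, h⟩
  · rintro ⟨K, n⟩
    choose N hN using fun β => exists_supSeminorm_le_mulSeminorm (multiDeriv_mem_diffOps (A := A)
      (m := m) β)
    let B := Finset.piAntidiag (Finset.univ : Finset (Fin m)) n
    refine ⟨B.image fun β => (K, N β), B.card, fun f => ?_⟩
    rw [Seminorm.comp_apply, LinearMap.id_apply, seminormFamily_apply, smul_apply,
      NNReal.smul_def, NNReal.coe_natCast, smul_eq_mul, ← nsmul_eq_mul]
    refine Finset.sum_le_card_nsmul _ _ _ fun β hβ => (hN β K f).trans ?_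
    exact Finset.le_sup (f := fun i : TopologicalSpace.Compacts (EuclideanSpace ℝ (Fin m)) × ℕ =>
      (mulSeminorm i.1 i.2 : Seminorm ℝ (SmoothFun m A)))
      (Finset.mem_image_of_mem (fun β => (K, N β)) hβ) f

/-! ### Completeness -/

/-- A smooth function as a continuous function. -/
noncomputable def toContinuousMap : SmoothFun m A →+ C(EuclideanSpace ℝ (Fin m), A) where
  toFun f := ⟨f, f.contDiff.continuous⟩
  map_zero' := rfl
  map_add' _ _ := rfl

theorem uniformContinuous_toContinuousMap :
    UniformContinuous (toContinuousMap : SmoothFun m A → C(EuclideanSpace ℝ (Fin m), A)) := by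
  refine (Metric.uniformity_basis_dist.compactConvergenceUniformity.tendsto_right_iff).2 ?_
  rintro ⟨K, ε⟩ ⟨hK, hε⟩
  rw [uniformity_eq_comap_nhds_zero, Filter.eventually_comap]
  have h := (continuous_supSeminorm (A := A) ⟨K, hK⟩).tendsto 0
  rw [map_zero] at h
  filter_upwards [h.eventually_lt_const hε]
  rintro _ hf ⟨f, g⟩ rfl x hx
  change dist (f x) (g x) < ε
  rw [dist_comm, dist_eq_norm]
  exact (norm_le_supSeminorm (g - f) (K := ⟨K, hK⟩) hx).trans_lt hf

/-- In this form, locally uniform convergence of the partial derivatives gives that of the Fréchet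
derivatives. -/
theorem hasFDerivAt (f : SmoothFun m A) (x : EuclideanSpace ℝ (Fin m)) :
    HasFDerivAt (f : EuclideanSpace ℝ (Fin m) → A)
      (∑ i, (EuclideanSpace.proj i : EuclideanSpace ℝ (Fin m) →L[ℝ] ℝ).smulRight
        (partialDeriv i f x)) x := by
  convert (f.differentiable x).hasFDerivAt using 1
  ext v
  conv_rhs => rw [← (EuclideanSpace.basisFun (Fin m) ℝ).sum_repr v, map_sum]
  simp [partialDeriv_apply]

/-- Along a Cauchy filter each T f converges locally uniformly to some g T. Differentiating the
limit shows that the partial derivatives of g T are the g (∂_i T), so g 1 is smooth and is the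
limit. -/
theorem completeSpace [CompleteSpace A] : CompleteSpace (SmoothFun m A) := by
  refine ⟨fun {F} hF => ?_⟩
  have hne : F.NeBot := hF.1
  have hlim : ∀ T : diffOps m A, ∃ g : C(EuclideanSpace ℝ (Fin m), A),
      Filter.Tendsto (fun f => toContinuousMap (T.1 f)) F (nhds g) := fun T =>
    cauchy_map_iff_exists_tendsto.1 (hF.map (uniformContinuous_toContinuousMap.comp
      (uniformContinuous_addMonoidHom_of_continuous (f := T.1.toAddMonoidHom)
        (continuous_of_mem_diffOps T.2))))
  choose g hg using hlim
  let d (i : Fin m) : diffOps m A := ⟨partialDeriv i, Submonoid.subset_closure ⟨i, rfl⟩⟩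
  let c (i : Fin m) : C(A, EuclideanSpace ℝ (Fin m) →L[ℝ] A) :=
    ⟨fun a => (EuclideanSpace.proj i : EuclideanSpace ℝ (Fin m) →L[ℝ] ℝ).smulRight a,
      (ContinuousLinearMap.smulRightL ℝ _ A (EuclideanSpace.proj i)).continuous⟩
  have hderiv : ∀ T x, HasFDerivAt (g T) (∑ i, c i (g (d i * T) x)) x := by
    intro T x
    have h1 : Filter.Tendsto (fun f => ∑ i, (c i).comp (toContinuousMap (partialDeriv i (T.1 f))))
        F (nhds (∑ i, (c i).comp (g (d i * T)))) :=
      tendsto_finsetSum _ fun i _ => ((c i).continuous_postcomp.tendsto _).comp (hg (d i * T))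
    rw [ContinuousMap.tendsto_iff_tendstoLocallyUniformly,
      ← tendstoLocallyUniformlyOn_univ] at h1
    have h2 := hasFDerivAt_of_tendstoLocallyUniformlyOn (f := fun f x => T.1 f x) (g := g T)
      isOpen_univ h1 (fun f x _ => ?_) (fun x _ => ?_) (Set.mem_univ x)
    · simpa using h2
    · change HasFDerivAt (T.1 f) _ x
      refine ((T.1 f).hasFDerivAt x).congr_fderiv ?_
      rw [ContinuousMap.sum_apply]
      rfl
    · exact ((continuous_eval_const x).tendsto _).comp (hg T)
  have hsmooth : ∀ T, ContDiff ℝ ∞ (g T) := by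
    intro T
    rw [contDiff_infty]
    intro n
    -- The derivative of g T involves the other limits g (d i * T), so all T are treated together.
    induction n generalizing T with
    | zero => exact contDiff_zero.2 (g T).continuous
    | succ n ih =>
      refine contDiff_succ_iff_hasFDerivAt.2 ⟨_, ?_, hderiv T⟩
      exact ContDiff.sum fun i _ =>
        (ContinuousLinearMap.smulRightL ℝ _ A (EuclideanSpace.proj i)).contDiff.comp (ih (d i * T))
  let h : SmoothFun m A := ⟨g 1, hsmooth 1⟩
  have hT : ∀ T (hT : T ∈ diffOps m A), toContinuousMap (T h) = g ⟨T, hT⟩ := by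
    intro T hT
    induction hT using Submonoid.closure_induction_left with
    | one => rfl
    | mul_left T hT U hU ih =>
      obtain ⟨i, rfl⟩ := hT
      ext x
      change fderiv ℝ (toContinuousMap (U h)) x _ = _
      rw [ih, (hderiv _ x).fderiv]
      have hc : ∀ j a, c j a (EuclideanSpace.single i 1) = if j = i then a else 0 := by
        intro j a
        change (EuclideanSpace.single i (1 : ℝ)) j • a = _
        simp
      simp only [sum_apply, hc, Finset.sum_ite_eq', Finset.mem_univ, if_true]
      rfl
  refine ⟨h, ?_⟩
  change Filter.Tendsto id F (nhds h)
  rw [(withSeminorms m A).tendsto_nhds]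
  rintro ⟨K, n⟩ ε hε
  have hβ : ∀ β : Fin m → ℕ,
      Filter.Tendsto (fun f => supSeminorm K (multiDeriv β (f - h))) F (nhds 0) := by
    intro β
    have h1 := hg ⟨_, multiDeriv_mem_diffOps β⟩
    rw [← hT, ContinuousMap.tendsto_iff_forall_isCompact_tendstoUniformlyOn] at h1
    have h2 := Metric.tendstoUniformlyOn_iff.1 (h1 K K.isCompact)
    rw [Metric.tendsto_nhds]
    intro ε hε
    filter_upwards [h2 (ε / 2) (half_pos hε)] with f hf
    rw [Real.dist_0_eq_abs, abs_of_nonneg (apply_nonneg _ _)]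
    refine (supSeminorm_le (half_pos hε).le fun x hx => ?_).trans_lt (half_lt_self hε)
    rw [map_sub]
    have := (hf x hx).le
    rwa [dist_comm, dist_eq_norm] at this
  have hsum := tendsto_finsetSum (Finset.piAntidiag (Finset.univ : Finset (Fin m)) n)
    fun β _ => hβ β
  rw [Finset.sum_const_zero] at hsum
  filter_upwards [hsum.eventually_lt_const hε] with f hf
  rwa [seminormFamily_apply]

theorem t2Space : T2Space (SmoothFun m A) := by
  have : T1Space (SmoothFun m A) := by
    refine (withSeminorms m A).T1_of_separating fun f hf => ?_
    by_contra! hcon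
    refine hf (ext fun x => ?_)
    have h := supSeminorm_multiDeriv_le ⟨{x}, isCompact_singleton⟩ 0 f
    rw [hcon, multiDeriv_zero] at h
    exact norm_le_zero_iff.1 ((norm_le_supSeminorm f (K := ⟨{x}, isCompact_singleton⟩) rfl).trans h)
  infer_instance

theorem isArensMichael [CompleteSpace A] : IsArensMichael ℝ (SmoothFun m A) where
  t2 := t2Space
  complete := completeSpace
  exists_seminorms := by
    let p := fun i : TopologicalSpace.Compacts (EuclideanSpace ℝ (Fin m)) × ℕ =>
      (mulSeminorm i.1 i.2 : Seminorm ℝ (SmoothFun m A))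
    refine ⟨Set.range p, ?_, ?_⟩
    · rintro _ ⟨i, rfl⟩
      exact mulSeminorm_mul_le i.1 i.2
    · have hp := withSeminorms_mulSeminorm m A
      refine hp.congr ?_ ?_
      · rintro ⟨_, i, rfl⟩
        exact Seminorm.bound_of_continuous hp _ (hp.continuous_seminorm i)
          |>.imp fun s ⟨C, _, h⟩ => ⟨C, h⟩
      · intro i
        exact ⟨{⟨p i, i, rfl⟩}, 1, by simp [p]⟩

end SmoothFun

/-! ### Exponentials of triangular matrices -/

namespace Matrix

section

open scoped Matrix.Norms.Operator

variable {ι : Type*} [Fintype ι] [DecidableEq ι]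

/-- The matrix norm opened here is auxiliary; entrywise statements keep it out of what follows. -/
theorem hasDerivAt_exp_smul_apply (M : Matrix ι ι ℂ) (j k : ι) (s : ℝ) :
    HasDerivAt (fun t : ℝ => NormedSpace.exp (t • M) j k)
      ((NormedSpace.exp (s • M) * M) j k) s :=
  hasDerivAt_pi.1 (hasDerivAt_pi.1 (hasDerivAt_exp_smul_const (𝕂 := ℝ) M s) j) k

theorem hasSum_exp_apply (M : Matrix ι ι ℂ) (j k : ι) :
    HasSum (fun n : ℕ => ((n.factorial : ℂ)⁻¹) • (M ^ n) j k) (NormedSpace.exp M j k) :=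
  Pi.hasSum.1 (Pi.hasSum.1 (NormedSpace.exp_series_hasSum_exp' (𝕂 := ℂ) M) j) k

end

variable {ι : Type*} [Fintype ι] [DecidableEq ι]

/-- The exponential of `isM`, for a real triangular matrix `M`, grows polynomially in `s`, with
bounds that depend only on the size and on the entries of `M`. -/
theorem norm_exp_smul_apply_le {M : Matrix ι ι ℝ} {r : ι → ℕ} {R : ℝ} (hR : 0 ≤ R)
    (hM : ∀ j k, j ≠ k → r k ≤ r j → M j k = 0) (hMR : ∀ j k, |M j k| ≤ R) (s : ℝ) (j k : ι) :
    ‖NormedSpace.exp (s • (Complex.I • M.map (algebraMap ℝ ℂ))) j k‖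
      ≤ ((1 + Fintype.card ι * R) * (1 + |s|)) ^ r k := by
  set N : Matrix ι ι ℂ := Complex.I • M.map (algebraMap ℝ ℂ) with hN
  set E : ℝ → Matrix ι ι ℂ := fun s => NormedSpace.exp (s • N) with hE
  have hNapp : ∀ l k, N l k = Complex.I * (M l k : ℂ) := fun l k => by simp [hN]
  -- Row j is fixed and the induction runs over the level of the column: in E' = E N, column k
  -- involves only itself and columns of lower level.
  have main : ∀ n k, r k = n → ∀ s, ‖E s j k‖ ≤ ((1 + Fintype.card ι * R) * (1 + |s|)) ^ n := by
    intro n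
    induction n using Nat.strong_induction_on with
    | _ n ih =>
      intro k hk s
      -- This integrating factor removes the diagonal term. It has modulus 1 because M is real, so N
      -- k k is purely imaginary.
      set v : ℝ → ℂ := fun t => E t j k * Complex.exp (-(t * N k k)) with hv
      have hnexp : ∀ t : ℝ, ‖Complex.exp (-(t * N k k))‖ = 1 := by
        intro t
        rw [hNapp, Complex.norm_exp]
        simp
      have hvd : ∀ t, HasDerivAt v
          ((∑ l ∈ Finset.univ.erase k, E t j l * N l k) * Complex.exp (-(t * N k k))) t := by
        intro t
        have h1 := hasDerivAt_exp_smul_apply N j k t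
        have h2 : HasDerivAt (fun t : ℝ => Complex.exp (-(t * N k k)))
            (Complex.exp (-(t * N k k)) * (-(1 * N k k))) t :=
          (((hasDerivAt_id t).ofReal_comp.mul_const (N k k)).neg).cexp
        refine (h1.mul h2).congr_deriv ?_
        rw [Matrix.mul_apply, ← Finset.sum_erase_add _ _ (Finset.mem_univ k)]
        simp only [hE]
        ring
      have hv0 : ‖v 0‖ ≤ 1 := by
        simp only [hv, hE, zero_smul, NormedSpace.exp_zero, norm_mul, hnexp, mul_one]
        rw [Matrix.one_apply]
        split_ifs <;> simp
      set c : ℝ := Fintype.card ι * R with hc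
      have hc0 : 0 ≤ c := by positivity
      have hbase : 1 ≤ (1 + c) * (1 + |s|) := by nlinarith [abs_nonneg s]
      have hnv : ‖E s j k‖ = ‖v s‖ := by simp [hv, hnexp]
      rw [hnv]
      rcases Nat.eq_zero_or_pos n with h0 | hpos
      · have hz : ∀ t, HasDerivAt v 0 t := by
          intro t
          convert hvd t using 1
          rw [Finset.sum_eq_zero, zero_mul]
          intro l hl
          rw [hNapp, hM l k (Finset.ne_of_mem_erase hl) (by omega)]
          simp
        have : v s = v 0 := is_const_of_deriv_eq_zero (fun t => (hz t).differentiableAt)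
          (fun t => (hz t).deriv) s 0
        rw [this, h0, pow_zero]
        exact hv0
      · obtain ⟨n, rfl⟩ : ∃ q, n = q + 1 := ⟨n - 1, by omega⟩
        set X : ℝ := (1 + c) * (1 + |s|) with hX
        have hbd : ∀ t ∈ Set.uIcc 0 s,
            ‖(∑ l ∈ Finset.univ.erase k, E t j l * N l k) * Complex.exp (-(t * N k k))‖
              ≤ c * X ^ n := by
          intro t ht
          have hts : |t| ≤ |s| := by simpa using Set.abs_sub_left_of_mem_uIcc ht
          rw [norm_mul, hnexp, mul_one]
          refine (norm_sum_le_of_le (f := fun l => E t j l * N l k) (n := fun _ => R * X ^ n) _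
            fun l hl => ?_).trans ?_
          · rw [norm_mul, hNapp, norm_mul, Complex.norm_I, one_mul, Complex.norm_real,
              Real.norm_eq_abs, mul_comm]
            by_cases hl' : r k ≤ r l
            · rw [hM l k (Finset.ne_of_mem_erase hl) hl', abs_zero, zero_mul]
              positivity
            · refine mul_le_mul (hMR l k) ?_ (norm_nonneg _) hR
              refine (ih (r l) (by omega) l rfl t).trans ?_
              have h1 : (1 + c) * (1 + |t|) ≤ X :=
                mul_le_mul_of_nonneg_left (by linarith) (by linarith)
              exact (pow_le_pow_left₀ (by positivity) h1 _).trans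
                (pow_le_pow_right₀ hbase (by omega))
          · rw [Finset.sum_const, nsmul_eq_mul, hc, mul_assoc]
            have : ((Finset.univ.erase k).card : ℝ) ≤ Fintype.card ι :=
              Nat.cast_le.2 (Finset.card_le_univ _)
            gcongr
        have hmv := (convex_uIcc (0 : ℝ) s).norm_image_sub_le_of_norm_hasDerivWithin_le
          (fun t _ => (hvd t).hasDerivWithinAt) hbd Set.left_mem_uIcc Set.right_mem_uIcc
        have h1 : ‖v s‖ ≤ 1 + c * X ^ n * |s| := by
          have := norm_le_norm_add_norm_sub' (v s) (v 0)
          rw [sub_zero, Real.norm_eq_abs] at hmv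
          linarith
        have h2 : 1 ≤ X ^ n := one_le_pow₀ hbase
        -- The first term absorbs the initial value 1, the second is the mean value estimate, and
        -- the others are nonnegative.
        have h3 : X ^ (n + 1) = X ^ n + c * X ^ n * |s| + X ^ n * |s| + c * X ^ n := by
          rw [pow_succ, hX]; ring
        have h4 : 0 ≤ X ^ n * |s| := by positivity
        have h5 : 0 ≤ c * X ^ n := by positivity
        linarith
  exact main _ k rfl s

end Matrix

/-! ### Polynomially bounded functions -/

/-- A real function is polynomially bounded from above. -/
def PolyBounded (u : ℝ → ℝ) : Prop :=
  ∃ (K : ℝ) (n : ℕ), 0 ≤ K ∧ ∀ s, u s ≤ K * (1 + |s|) ^ n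

namespace PolyBounded

theorem mono {u v : ℝ → ℝ} (hv : PolyBounded v) (h : ∀ s, u s ≤ v s) : PolyBounded u :=
  let ⟨K, n, hK, hn⟩ := hv
  ⟨K, n, hK, fun s => (h s).trans (hn s)⟩

theorem zero : PolyBounded fun _ => 0 := ⟨0, 0, le_rfl, by simp⟩

theorem add {u v : ℝ → ℝ} (hu : PolyBounded u) (hv : PolyBounded v) :
    PolyBounded fun s => u s + v s := by
  obtain ⟨K, n, hK, hn⟩ := hu
  obtain ⟨K', n', hK', hn'⟩ := hv
  refine ⟨K + K', max n n', add_nonneg hK hK', fun s => ?_⟩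
  have h1 : 1 ≤ 1 + |s| := by linarith [abs_nonneg s]
  rw [add_mul]
  refine add_le_add ((hn s).trans ?_) ((hn' s).trans ?_)
  · exact mul_le_mul_of_nonneg_left (pow_le_pow_right₀ h1 (le_max_left _ _)) hK
  · exact mul_le_mul_of_nonneg_left (pow_le_pow_right₀ h1 (le_max_right _ _)) hK'

theorem const_mul {u : ℝ → ℝ} (hu : PolyBounded u) {c : ℝ} (hc : 0 ≤ c) :
    PolyBounded fun s => c * u s := by
  obtain ⟨K, n, hK, hn⟩ := hu
  refine ⟨c * K, n, mul_nonneg hc hK, fun s => ?_⟩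
  rw [mul_assoc]
  exact mul_le_mul_of_nonneg_left (hn s) hc

theorem sum {κ : Type*} {u : κ → ℝ → ℝ} (t : Finset κ) (h : ∀ i ∈ t, PolyBounded (u i)) :
    PolyBounded fun s => ∑ i ∈ t, u i s := by
  classical
  induction t using Finset.induction_on with
  | empty => simpa using zero
  | insert i t hi ih =>
    simp only [Finset.sum_insert hi]
    exact (h i (Finset.mem_insert_self i t)).add
      (ih fun j hj => h j (Finset.mem_insert_of_mem hj))

end PolyBounded

/-- The coefficients of the power series of `e^{isb}`. -/
noncomputable def expCoeff (s : ℝ) (n : ℕ) : ℂ :=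
  (n.factorial : ℂ)⁻¹ * (Complex.I * (s : ℂ)) ^ n

theorem norm_expCoeff (s : ℝ) (n : ℕ) : ‖expCoeff s n‖ = |s| ^ n / n.factorial := by
  simp [expCoeff, div_eq_inv_mul]

/-- The powers of M are real, so a real functional acts on the coefficients alone. It is applied
with L the real or the imaginary part. -/
theorem Matrix.hasSum_expCoeff {ι : Type*} [Fintype ι] [DecidableEq ι] (L : ℂ →L[ℝ] ℝ)
    (M : Matrix ι ι ℝ) (j k : ι) (s : ℝ) :
    HasSum (fun n => L (expCoeff s n) * (M ^ n) j k)
      (L (NormedSpace.exp (s • (Complex.I • M.map (algebraMap ℝ ℂ))) j k)) := by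
  refine (L.hasSum (Matrix.hasSum_exp_apply _ j k)).congr_fun fun n => ?_
  have h : s • (Complex.I • M.map (algebraMap ℝ ℂ))
      = (Complex.I * (s : ℂ)) • M.map (algebraMap ℝ ℂ) := by
    ext a b
    simp
    ring
  have h2 : (M.map (algebraMap ℝ ℂ)) ^ n = (M ^ n).map (algebraMap ℝ ℂ) :=
    (map_pow (algebraMap ℝ ℂ).mapMatrix M n).symm
  have h3 : (n.factorial : ℂ)⁻¹ • ((s • (Complex.I • M.map (algebraMap ℝ ℂ))) ^ n) j k
      = (M ^ n) j k • expCoeff s n := by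
    rw [h, smul_pow, h2]
    simp [expCoeff]
    ring
  change _ = L _
  rw [h3, map_smul, smul_eq_mul, mul_comm]

/-! ### Convergence of the exponential series -/

namespace SmoothFun

section

variable {m : ℕ} {A : Type*} [NormedRing A] [NormedAlgebra ℝ A]

theorem summable_of_summable_mulSeminorm [CompleteSpace A] {u : ℕ → SmoothFun m A}
    (h : ∀ K n, Summable fun k => mulSeminorm K n (u k)) : Summable u := by
  have : CompleteSpace (SmoothFun m A) := completeSpace
  rw [summable_iff_vanishing]
  intro e he
  obtain ⟨t, r, hr, hte⟩ := ((withSeminorms_mulSeminorm m A).mem_nhds_iff 0 e).1 he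
  have hs : Summable fun k => ∑ i ∈ t, mulSeminorm i.1 i.2 (u k) :=
    summable_sum fun i _ => h i.1 i.2
  obtain ⟨b, hb⟩ := summable_iff_vanishing.1 hs _ (Metric.ball_mem_nhds 0 hr)
  refine ⟨b, fun c hc => hte ?_⟩
  have h1 := hb c hc
  rw [Seminorm.mem_ball_zero]
  rw [mem_ball_zero_iff, Real.norm_eq_abs] at h1
  refine lt_of_le_of_lt ?_ ((le_abs_self _).trans_lt h1)
  refine (Finset.le_sum_of_subadditive _ (map_zero _).le (map_add_le_add _) c u).trans
    (Finset.sum_le_sum fun k _ => ?_)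
  refine (Seminorm.finset_sup_le_sum _ t (u k)).trans_eq ?_
  rw [sum_apply]

theorem summable_expCoeff [CompleteSpace A] {L : ℂ →L[ℝ] ℝ} (hL : ∀ z, |L z| ≤ ‖z‖)
    (a : SmoothFun m A) (s : ℝ) : Summable fun n => L (expCoeff s n) • a ^ n := by
  refine summable_of_summable_mulSeminorm fun K n => ?_
  set q := mulSeminorm (A := A) K n
  refine Summable.of_nonneg_of_le (fun _ => apply_nonneg _ _) (fun k => ?_)
    ((Real.summable_pow_div_factorial (|s| * q a)).mul_left (q 1 + 1))
  -- The constant is needed for k = 0, since A is not assumed to have a unit of norm 1.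
  have hpow : q (a ^ k) ≤ (q 1 + 1) * q a ^ k := by
    induction k with
    | zero => simp
    | succ k ih =>
      rw [pow_succ, pow_succ, ← mul_assoc]
      exact (mulSeminorm_mul_le K n _ _).trans (mul_le_mul_of_nonneg_right ih (apply_nonneg _ _))
  rw [map_smul_eq_mul, Real.norm_eq_abs]
  calc |L (expCoeff s k)| * q (a ^ k) ≤ (|s| ^ k / k.factorial) * ((q 1 + 1) * q a ^ k) := by
        refine mul_le_mul ((hL _).trans_eq (norm_expCoeff s k)) hpow (apply_nonneg _ _) ?_
        positivity
    _ = _ := by rw [mul_pow]; ring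

variable (A) in
/-- Evaluation at a point. -/
noncomputable def evalHom (x : EuclideanSpace ℝ (Fin m)) : SmoothFun m A →ₐ[ℝ] A where
  toFun f := f x
  map_one' := rfl
  map_mul' _ _ := rfl
  map_zero' := rfl
  map_add' _ _ := rfl
  commutes' _ := rfl

theorem continuous_evalHom (x : EuclideanSpace ℝ (Fin m)) : Continuous (evalHom A x) :=
  (continuous_eval_const x).comp uniformContinuous_toContinuousMap.continuous

end

/-! ### Triangular representations and polynomial bounds -/

section

variable {m p : ℕ}

/-- The matrix entries of an upper triangular matrix. -/
noncomputable def entry (j k : Fin p) : UpperTriangular p →L[ℝ] ℝ :=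
  LinearMap.toContinuousLinearMap
    ((LinearMap.proj k).comp ((LinearMap.proj j).comp
      (Matrix.blockTriangularSubalgebra ℝ ℝ (id : Fin p → Fin p)).val.toLinearMap))

/-- Each entry of each iterated partial derivative is an entry of a triangular representation of
`C^∞(ℝ^m, T_p)`. -/
theorem exists_triangular_representation {T : Module.End ℝ (SmoothFun m (UpperTriangular p))}
    (hT : T ∈ diffOps m (UpperTriangular p)) :
    ∃ (ι : Type) (_ : Fintype ι) (_ : DecidableEq ι)
      (ρ : EuclideanSpace ℝ (Fin m) → SmoothFun m (UpperTriangular p) →ₐ[ℝ] Matrix ι ι ℝ)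
      (r : ι → ℕ), (∀ x f j k, j ≠ k → r k ≤ r j → ρ x f j k = 0) ∧
        (∀ f j k, Continuous fun x => ρ x f j k) ∧
        ∀ j k, ∃ j' k', ∀ x f, entry j k (T f x) = ρ x f j' k' := by
  induction hT using Submonoid.closure_induction_right with
  | one =>
    refine ⟨Fin p, inferInstance, inferInstance, fun x =>
      (Matrix.blockTriangularSubalgebra ℝ ℝ (id : Fin p → Fin p)).val.comp (evalHom _ x),
      Fin.val, ?_, ?_, ?_⟩
    · intro x f j k hjk hr
      exact (f x).2 (lt_of_le_of_ne hr hjk.symm)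
    · intro f j k
      exact (entry j k).continuous.comp f.contDiff.continuous
    · exact fun j k => ⟨j, k, fun _ _ => rfl⟩
  | mul_right T _ U hU ih =>
    obtain ⟨i, rfl⟩ := hU
    obtain ⟨ι, _, _, ρ, r, h0, hc, hT⟩ := ih
    let σ (x : EuclideanSpace ℝ (Fin m)) :
        SmoothFun m (UpperTriangular p) →ₐ[ℝ] Matrix (ι ⊕ ι) (ι ⊕ ι) ℝ :=
      AlgHom.ofLinearMap
        { toFun := fun f => Matrix.fromBlocks (ρ x f) (ρ x (partialDeriv i f)) 0 (ρ x f)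
          map_add' := fun f g => by simp [Matrix.fromBlocks_add]
          map_smul' := fun c f => by simp [Matrix.fromBlocks_smul] }
        (by simp [partialDeriv_one])
        (fun f g => by simp [partialDeriv_mul, Matrix.fromBlocks_multiply, add_comm])
    -- Levels in the second copy are raised by one because the diagonal of the upper right block,
    -- that of ρ x (∂_i f), need not vanish.
    refine ⟨ι ⊕ ι, inferInstance, inferInstance, σ, Sum.elim r fun j => r j + 1, ?_, ?_, ?_⟩
    · rintro x f (j | j) (k | k) hjk hr
      · exact h0 x f j k (by simpa using hjk) hr
      · exact h0 x _ j k (by rintro rfl; simp at hr) (by simp at hr; omega)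
      · rfl
      · exact h0 x f j k (by simpa using hjk) (by simpa using hr)
    · rintro f (j | j) (k | k)
      · exact hc f j k
      · exact hc _ j k
      · exact continuous_const
      · exact hc f j k
    · intro j k
      obtain ⟨j', k', h⟩ := hT j k
      exact ⟨Sum.inl j', Sum.inr k', fun x f => h x (partialDeriv i f)⟩

theorem exists_norm_le_sum_entry (p : ℕ) :
    ∃ C : ℝ, 0 ≤ C ∧ ∀ a : UpperTriangular p, ‖a‖ ≤ C * ∑ j, ∑ k, |entry j k a| := by
  let f : UpperTriangular p →ₗ[ℝ] (Fin p → Fin p → ℝ) :=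
    LinearMap.pi fun j => LinearMap.pi fun k => (entry j k).toLinearMap
  have hf : f.ker = ⊥ := by
    rw [LinearMap.ker_eq_bot]
    intro a b hab
    exact Subtype.ext (Matrix.ext fun j k => congrFun (congrFun hab j) k)
  obtain ⟨C, -, hC⟩ := f.exists_antilipschitzWith hf
  refine ⟨C, C.2, fun a => (ZeroHomClass.bound_of_antilipschitz f hC a).trans ?_⟩
  refine mul_le_mul_of_nonneg_left ?_ C.2
  have h0 : ∀ j, 0 ≤ ∑ k, |entry j k a| := fun j => Finset.sum_nonneg fun _ _ => abs_nonneg _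
  refine (pi_norm_le_iff_of_nonneg (Finset.sum_nonneg fun j _ => h0 j)).2 fun j => ?_
  refine le_trans ?_ (Finset.single_le_sum (fun j _ => h0 j) (Finset.mem_univ j))
  refine (pi_norm_le_iff_of_nonneg (h0 j)).2 fun k => ?_
  exact Finset.single_le_sum (f := fun k => |entry j k a|) (fun _ _ => abs_nonneg _)
    (Finset.mem_univ k)

variable {L : ℂ →L[ℝ] ℝ} {a : SmoothFun m (UpperTriangular p)}
  {u : ℝ → SmoothFun m (UpperTriangular p)}

/-- Applying T, evaluation at x and an entry termwise turns the series of a into an entry of the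
series of ρ x a. By continuity in x the entries of ρ x a are bounded on K, so the matrix estimate is
uniform there. -/
theorem exists_entry_bound (hL : ∀ z, |L z| ≤ ‖z‖)
    (hu : ∀ s, HasSum (fun n => L (expCoeff s n) • a ^ n) (u s))
    (K : TopologicalSpace.Compacts (EuclideanSpace ℝ (Fin m)))
    {T : Module.End ℝ (SmoothFun m (UpperTriangular p))}
    (hT : T ∈ diffOps m (UpperTriangular p)) (j k : Fin p) :
    ∃ v, PolyBounded v ∧ (∀ s, 0 ≤ v s) ∧ ∀ s, ∀ x ∈ K, |entry j k (T (u s) x)| ≤ v s := by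
  obtain ⟨ι, _, _, ρ, r, h0, hc, hρ⟩ := exists_triangular_representation hT
  obtain ⟨j', k', hjk⟩ := hρ j k
  have hb : ∀ i : ι × ι, ∃ R, ∀ x ∈ K, |ρ x a i.1 i.2| ≤ R := fun i =>
    K.isCompact.exists_bound_of_continuousOn (hc a i.1 i.2).continuousOn
  choose R hR using hb
  set R' : ℝ := ∑ i, |R i|
  have hR' : ∀ x ∈ K, ∀ i l, |ρ x a i l| ≤ R' := fun x hx i l =>
    ((hR (i, l) x hx).trans (le_abs_self _)).trans
      (Finset.single_le_sum (f := fun i => |R i|) (fun _ _ => abs_nonneg _) (Finset.mem_univ _))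
  have hR0 : 0 ≤ R' := Finset.sum_nonneg fun _ _ => abs_nonneg _
  refine ⟨fun s => (1 + Fintype.card ι * R') ^ r k' * (1 + |s|) ^ r k',
    ⟨_, r k', by positivity, fun _ => le_rfl⟩, fun s => by positivity, fun s x hx => ?_⟩
  change _ ≤ (1 + Fintype.card ι * R') ^ r k' * (1 + |s|) ^ r k'
  let φ : SmoothFun m (UpperTriangular p) →+ ℝ :=
    (entry j k).toLinearMap.toAddMonoidHom.comp
      ((evalHom (UpperTriangular p) x).toLinearMap.toAddMonoidHom.comp T.toAddMonoidHom)
  have hφ : Continuous φ := (entry j k).continuous.comp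
    ((continuous_evalHom x).comp (continuous_of_mem_diffOps hT))
  have h1 := (hu s).map φ hφ
  have h2 : (φ ∘ fun n => L (expCoeff s n) • a ^ n)
      = fun n => L (expCoeff s n) * (ρ x a ^ n) j' k' := by
    funext n
    change entry j k (T (L (expCoeff s n) • a ^ n) x) = _
    rw [hjk, map_smul, map_pow]
    rfl
  rw [h2] at h1
  have h3 : entry j k (T (u s) x) = _ := h1.unique (Matrix.hasSum_expCoeff L (ρ x a) j' k' s)
  rw [h3, ← mul_pow]
  exact (hL _).trans (Matrix.norm_exp_smul_apply_le hR0 (h0 x a) (hR' x hx) s j' k')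

theorem polyBounded_supSeminorm (hL : ∀ z, |L z| ≤ ‖z‖)
    (hu : ∀ s, HasSum (fun n => L (expCoeff s n) • a ^ n) (u s))
    (K : TopologicalSpace.Compacts (EuclideanSpace ℝ (Fin m)))
    {T : Module.End ℝ (SmoothFun m (UpperTriangular p))}
    (hT : T ∈ diffOps m (UpperTriangular p)) :
    PolyBounded fun s => supSeminorm K (T (u s)) := by
  obtain ⟨C, hC, hCa⟩ := exists_norm_le_sum_entry p
  choose v hv hv0 hvb using fun j k => exists_entry_bound hL hu K hT j k
  refine ((PolyBounded.sum Finset.univ fun j _ => PolyBounded.sum Finset.univ fun k _ =>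
    hv j k).const_mul hC).mono fun s => ?_
  refine supSeminorm_le (mul_nonneg hC (Finset.sum_nonneg fun j _ => Finset.sum_nonneg
    fun k _ => hv0 j k s)) fun x hx => (hCa _).trans (mul_le_mul_of_nonneg_left ?_ hC)
  exact Finset.sum_le_sum fun j _ => Finset.sum_le_sum fun k _ => hvb j k s x hx

theorem polyBounded_seminorm (hL : ∀ z, |L z| ≤ ‖z‖)
    (hu : ∀ s, HasSum (fun n => L (expCoeff s n) • a ^ n) (u s))
    {q : Seminorm ℝ (SmoothFun m (UpperTriangular p))} (hq : Continuous q) :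
    PolyBounded fun s => q (u s) := by
  obtain ⟨t, C, -, h⟩ := Seminorm.bound_of_continuous (withSeminorms m (UpperTriangular p)) q hq
  refine ((PolyBounded.sum t fun i _ => PolyBounded.sum
    (u := fun β s => supSeminorm i.1 (multiDeriv β (u s)))
    (Finset.piAntidiag (Finset.univ : Finset (Fin m)) i.2) fun β _ =>
    polyBounded_supSeminorm hL hu i.1 (multiDeriv_mem_diffOps β)).const_mul C.2).mono fun s => ?_
  refine (h (u s)).trans ?_
  rw [smul_apply, NNReal.smul_def, smul_eq_mul]
  refine mul_le_mul_of_nonneg_left ((Seminorm.finset_sup_le_sum _ t (u s)).trans_eq ?_) C.2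
  rw [sum_apply]
  exact Finset.sum_congr rfl fun i _ => seminormFamily_apply i.1 i.2 _

end

end SmoothFun

/-! ### The complexification -/

namespace Complexification

variable {A : Type*} [Ring A] [Algebra ℝ A]

theorem mk_add (a b c d : A) : mk (a + c) (b + d) = mk a b + mk c d := by
  change ((1 : ℂ) ⊗ₜ[ℝ] (a + c) + Complex.I ⊗ₜ[ℝ] (b + d) : ℂ ⊗[ℝ] A)
    = ((1 : ℂ) ⊗ₜ[ℝ] a + Complex.I ⊗ₜ[ℝ] b) + ((1 : ℂ) ⊗ₜ[ℝ] c + Complex.I ⊗ₜ[ℝ] d)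
  rw [TensorProduct.tmul_add, TensorProduct.tmul_add]
  abel

theorem mk_smul (r : ℝ) (a b : A) : mk (r • a) (r • b) = (r : ℂ) • mk a b := by
  change ((1 : ℂ) ⊗ₜ[ℝ] (r • a) + Complex.I ⊗ₜ[ℝ] (r • b) : ℂ ⊗[ℝ] A)
    = (r : ℂ) • ((1 : ℂ) ⊗ₜ[ℝ] a + Complex.I ⊗ₜ[ℝ] b)
  rw [smul_add, TensorProduct.smul_tmul', TensorProduct.smul_tmul', ← TensorProduct.smul_tmul,
    ← TensorProduct.smul_tmul]
  simp

/-- This matches the terms of the complex exponential series with those of the two real series. -/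
theorem smul_mk_zero_pow (z w : ℂ) (a : A) (n : ℕ) :
    z • (w • mk a 0) ^ n = mk ((z * w ^ n).re • a ^ n) ((z * w ^ n).im • a ^ n) := by
  change (z • (w • ((1 : ℂ) ⊗ₜ[ℝ] a + Complex.I ⊗ₜ[ℝ] (0 : A) : ℂ ⊗[ℝ] A)) ^ n : ℂ ⊗[ℝ] A)
    = ((1 : ℂ) ⊗ₜ[ℝ] ((z * w ^ n).re • a ^ n) + Complex.I ⊗ₜ[ℝ] ((z * w ^ n).im • a ^ n) : ℂ ⊗[ℝ] A)
  rw [TensorProduct.tmul_zero, add_zero, smul_pow, smul_smul, Algebra.TensorProduct.tmul_pow,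
    one_pow, TensorProduct.smul_tmul', ← TensorProduct.smul_tmul, ← TensorProduct.smul_tmul,
    ← TensorProduct.add_tmul]
  congr 1
  apply Complex.ext <;> simp

variable (A) in
/-- The bijection `(a, b) ↦ a + ib` as an additive map. -/
noncomputable def mkHom : A × A →+ Complexification A :=
  AddMonoidHom.mk' (fun z => mk z.1 z.2) fun z w => mk_add z.1 z.2 w.1 w.2

theorem continuous_mkHom [TopologicalSpace A] : Continuous (mkHom A) := continuous_coinduced_rng

/-- The seminorm induced on the real algebra by a seminorm on its complexification and an
`ℝ`-linear embedding. -/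
noncomputable def pullback (q : Seminorm ℂ (Complexification A)) (f : A →ₗ[ℝ] A × A) :
    Seminorm ℝ A :=
  Seminorm.of (fun a => q (mkHom A (f a)))
    (fun a b => by rw [map_add, map_add]; exact map_add_le_add q _ _)
    (fun c a => by
      have h : mkHom A (f (c • a)) = (c : ℂ) • mkHom A (f a) := by
        rw [map_smul]; exact mk_smul c _ _
      rw [h, map_smul_eq_mul, Complex.norm_real])

end Complexification

theorem mainTheorem5 (m p : ℕ) :
    IsPolynomialGrowthAlgebra (SmoothFun m (UpperTriangular p)) := by
  have hcomplete : CompleteSpace (UpperTriangular p) := FiniteDimensional.complete ℝ _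
  refine ⟨SmoothFun.isArensMichael, fun a => ?_⟩
  have hre : ∀ z, |Complex.reCLM z| ≤ ‖z‖ := Complex.abs_re_le_norm
  have him : ∀ z, |Complex.imCLM z| ≤ ‖z‖ := Complex.abs_im_le_norm
  choose u hu using fun s => SmoothFun.summable_expCoeff hre a s
  choose v hv using fun s => SmoothFun.summable_expCoeff him a s
  refine ⟨fun s => Complexification.mkHom _ (u s, v s), fun s => ?_, fun q hq _ => ?_⟩
  · refine (((hu s).prodMk (hv s)).map (Complexification.mkHom _)
      Complexification.continuous_mkHom).congr_fun fun n => ?_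
    exact Complexification.smul_mk_zero_pow _ _ a n
  -- Restricted to each of the summands A and iA, q becomes a continuous real seminorm, to which the
  -- real bounds apply.
  · have hb : ∀ f : SmoothFun m (UpperTriangular p) →ₗ[ℝ] _, Continuous f →
        Continuous (Complexification.pullback q f) := fun f hf =>
      hq.comp (Complexification.continuous_mkHom.comp hf)
    obtain ⟨K, n, hK, h⟩ :=
      (SmoothFun.polyBounded_seminorm hre hu (hb (LinearMap.inl ℝ _ _)
        (continuous_id.prodMk continuous_const))).add
      (SmoothFun.polyBounded_seminorm him hv (hb (LinearMap.inr ℝ _ _)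
        (continuous_const.prodMk continuous_id)))
    -- K may be 0, while the definition requires a positive constant.
    refine ⟨K + 1, n, by linarith, n.cast_nonneg, fun s => ?_⟩
    have h1 : Complexification.mkHom _ (u s, v s) = Complexification.mkHom _ (u s, 0)
        + Complexification.mkHom _ (0, v s) := by
      rw [← map_add, Prod.mk_add_mk, add_zero, zero_add]
    rw [Real.rpow_natCast]
    change q (Complexification.mkHom _ (u s, v s)) ≤ _
    rw [h1]
    refine ((map_add_le_add q _ _).trans (h s)).trans ?_
    have : 0 ≤ (1 + |s|) ^ n := by positivity
    linarith
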